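/- Only edge colorings are considered, and $P_5$ denotes the path on five vertices. A colored graph is rainbow if its edges have pairwise different colors, and monochromatic if all its edges have the same color. For a graph $H$ and an integer $k\ge 1$, let $R_k(H)$ be the least $N$ such that every coloring of the edges of $K_N$ using at most $k$ colors contains a monochromatic copy of $H$; for graphs $G$ and $H$, let $gr_k(G:H)$ be the least $N$ such that every coloring of the edges of $K_N$ using at most $k$ colors contains a rainbow copy of $G$ or a monochromatic copy of $H$. Write $nK_r$ for the disjoint union of $n$ copies of the complete graph $K_r$. Theorem. Let $r\ge 3$ and $2\le n\le r-1$. Then $R_3(nK_r)$ and, for every integer $k\ge 1$, $gr_k(P_5:nK_r)$ exist, and $$gr_k(P_5:nK_r)\le R_3(nK_r)\quad\text{for every } k\ge 1,$$ with equality $$gr_k(P_5:nK_r)=R_3(nK_r)\quad\text{for every } k\ge 3.$$ -/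

import Mathlib

open SimpleGraph

/-- The disjoint union of `n` copies of a graph `H`, usually written `nH`. -/
def disjointCopies (n : ℕ) {V : Type*} (H : SimpleGraph V) : SimpleGraph (Fin n × V) where
  Adj x y := x.1 = y.1 ∧ H.Adj x.2 y.2
  symm := ⟨fun _ _ h => ⟨h.1.symm, h.2.symm⟩⟩
  loopless := ⟨fun _ h => H.irrefl h.2⟩

/-- The edge coloring `C` of the complete graph on `W` contains a monochromatic copy of `H`:
a (not necessarily induced) copy of `H` all of whose edges have a single color. -/
def HasMonochromaticCopy {W K V : Type*} (C : TopEdgeLabeling W K) (H : SimpleGraph V) : Prop :=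
  ∃ c : K, H ⊑ C.labelGraph c

/-- The edge coloring `C` of the complete graph on `W` contains a rainbow copy of `G`:
a (not necessarily induced) copy of `G` whose edges have pairwise different colors. -/
def HasRainbowCopy {W K V : Type*} (C : TopEdgeLabeling W K) (G : SimpleGraph V) : Prop :=
  ∃ f : Copy G (⊤ : SimpleGraph W), Function.Injective fun e : G.edgeSet => C (f.mapEdgeSet e)

/-- The set of all `N` such that every coloring of the edges of `K_N` using at most `k` colors
contains a monochromatic copy of `H`. -/
def ramseySet (k : ℕ) {V : Type*} (H : SimpleGraph V) : Set ℕ :=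
  {N | ∀ C : TopEdgeLabeling (Fin N) (Fin k), HasMonochromaticCopy C H}

/-- The `k`-color Ramsey number `R_k(H)`, the least element of `ramseySet k H`
(meaningful when that set is nonempty). -/
noncomputable def ramseyNumber (k : ℕ) {V : Type*} (H : SimpleGraph V) : ℕ :=
  sInf (ramseySet k H)

/-- The set of all `N` such that every coloring of the edges of `K_N` using at most `k` colors
contains a rainbow copy of `G` or a monochromatic copy of `H`. -/
def gallaiRamseySet (k : ℕ) {U V : Type*} (G : SimpleGraph U) (H : SimpleGraph V) : Set ℕ :=
  {N | ∀ C : TopEdgeLabeling (Fin N) (Fin k), HasRainbowCopy C G ∨ HasMonochromaticCopy C H}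

/-- The Gallai-Ramsey number `gr_k(G : H)`, the least element of `gallaiRamseySet k G H`
(meaningful when that set is nonempty). -/
noncomputable def gallaiRamseyNumber (k : ℕ) {U V : Type*}
    (G : SimpleGraph U) (H : SimpleGraph V) : ℕ :=
  sInf (gallaiRamseySet k G H)

/-! A rainbow `P_5` needs four colors, so a three-coloring has none and every Gallai-Ramsey bound
with `k ≥ 3` is also a bound for `R_3`. The content is the converse bound.

By `RainbowPathFree.structure`, a coloring of at least six vertices without rainbow `P_5` uses at
most three colors, or becomes monochromatic after deleting at most three vertices, or has a dominant
color `c` such that each vertex sees at most one other color. The first kind is a three-coloring. In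
the second a clique on `N - 3` vertices contains `nK_r`, because `N > (r-1)^3` by
`lt_of_mem_ramseySet`.

The third kind, when it has no monochromatic `nK_r`, is turned into a three-coloring without one
(`exists_three_coloring_of_dominant`). Fewer than `r` colors other than `c` contain a `K_r`, since
transversals of `r` such cliques would give `nK_r` in color `c`. Two of these colors are kept. For
each other one a set of at most `(n-1)r` vertices meets all its `K_r`. The union `J` of these sets
is small enough to be recolored lexicographically so that no monochromatic `K_r` meets `J`; the
remaining colors outside `J` can then be merged. -/

/-- A binary function on vertices, viewed as an edge coloring, without a rainbow path on five
vertices. -/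
def RainbowPathFree {V K : Type*} (e : V → V → K) : Prop :=
  ∀ a b c d f : V, [a, b, c, d, f].Nodup → ¬ [e a b, e b c, e c d, e d f].Nodup

/-! ### Rainbow four-cycles -/

section Structure

variable {V K : Type*} {e : V → V → K}

theorem RainbowPathFree.or (h : RainbowPathFree e) (a b c d f : V) (hV : [a, b, c, d, f].Nodup) :
    e a b = e b c ∨ e a b = e c d ∨ e a b = e d f ∨ e b c = e c d ∨ e b c = e d f ∨
      e c d = e d f := by
  have := h a b c d f hV
  simp only [List.nodup_cons, List.mem_cons, List.not_mem_nil, not_or, not_and, or_false,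
    List.nodup_nil] at this
  tauto

/-- A rainbow four-cycle together with a vertex outside. -/
theorem RainbowPathFree.cycle_vertex (h : RainbowPathFree e) (hs : ∀ x y, e x y = e y x)
    {a b c d w : V} (hV : [a, b, c, d, w].Nodup)
    (hC : [e a b, e b c, e c d, e d a].Nodup) :
    (e w a = e b c ∧ e w c = e a b) ∨ (e w a = e c d ∧ e w c = e d a) := by
  -- The first four paths confine `e w a` to the colors of `b c` and `c d`, and `e w c` to those of
  -- `a b` and `d a`. The last two, through `c w a`, correlate the two choices.
  have h1 := h.or w a b c d (by grind)
  have h2 := h.or w a d c b (by grind)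
  have h3 := h.or w c d a b (by grind)
  have h4 := h.or w c b a d (by grind)
  have h5 := h.or b c w a d (by grind)
  have h6 := h.or d c w a b (by grind)
  grind

/-- `cycle_vertex`, applied to both pairs of opposite vertices, leaves four patterns for the edges
from each outside vertex to the cycle. Every combination of patterns produces a rainbow path through
both outside vertices. -/
theorem RainbowPathFree.not_rainbow_cycle (h : RainbowPathFree e) (hs : ∀ x y, e x y = e y x)
    {a b c d w w' : V} (hV : [a, b, c, d, w, w'].Nodup) :
    ¬ [e a b, e b c, e c d, e d a].Nodup := by
  intro hC
  have p1 := h.cycle_vertex hs (a := a) (b := b) (c := c) (d := d) (w := w) (by grind) hC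
  have p2 := h.cycle_vertex hs (a := b) (b := c) (c := d) (d := a) (w := w) (by grind) (by grind)
  have p3 := h.cycle_vertex hs (a := a) (b := b) (c := c) (d := d) (w := w') (by grind) hC
  have p4 := h.cycle_vertex hs (a := b) (b := c) (c := d) (d := a) (w := w') (by grind) (by grind)
  have h1 := h.or w' a b c w (by grind)
  have h2 := h.or w a b c w' (by grind)
  have h3 := h.or w' b c d w (by grind)
  have h4 := h.or w b c d w' (by grind)
  have h5 := h.or w' c d a w (by grind)
  have h6 := h.or w c d a w' (by grind)
  have h7 := h.or w' d a b w (by grind)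
  have h8 := h.or w d a b w' (by grind)
  have h9 := h.or d w a w' c (by grind)
  have h10 := h.or d w' a w c (by grind)
  have h11 := h.or c w a w' b (by grind)
  have h12 := h.or c w' a w b (by grind)
  have h13 := h.or c w a w' d (by grind)
  have h14 := h.or c w' a w d (by grind)
  clear hV h
  simp only [List.nodup_cons, List.mem_cons, List.not_mem_nil, not_or,
    List.nodup_nil, not_false_eq_true, and_true] at hC
  rcases p1 with p1 | p1 <;> rcases p3 with p3 | p3 <;> rcases p2 with p2 | p2 <;>
    rcases p4 with p4 | p4 <;> grind (splits := 20)

end Structure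

/-! ### A vertex seeing at least four colors -/

section Structure

variable {V K : Type*} {e : V → V → K}

theorem exists_notMem_of_length_lt_card [Fintype V] (l : List V)
    (hl : l.length < Fintype.card V) : ∃ x, x ∉ l := by
  classical
  by_contra! hx
  have : Finset.univ ⊆ l.toFinset := fun x _ => by simpa using hx x
  have := (Finset.card_le_card this).trans l.toFinset_card_le
  rw [Finset.card_univ] at this
  omega

theorem RainbowPathFree.not_rainbow_cycle_of_card [Fintype V] (h : RainbowPathFree e)
    (hs : ∀ x y, e x y = e y x) (hc : 6 ≤ Fintype.card V) {a b c d : V}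
    (hV : [a, b, c, d].Nodup) : ¬ [e a b, e b c, e c d, e d a].Nodup := by
  obtain ⟨w, hw⟩ := exists_notMem_of_length_lt_card [a, b, c, d] (by simp; omega)
  obtain ⟨w', hw'⟩ := exists_notMem_of_length_lt_card [a, b, c, d, w] (by simp; omega)
  exact h.not_rainbow_cycle hs (w := w) (w' := w') (by grind)

/-- Two further colors at `v` restrict the colors at the end `z` of a path `v, y, z`. -/
theorem RainbowPathFree.eq_or_eq [Fintype V] (h : RainbowPathFree e)
    (hs : ∀ x y, e x y = e y x) (hc : 6 ≤ Fintype.card V) {v y z x x' w : V}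
    (hvy : v ≠ y) (hvz : v ≠ z) (hyz : y ≠ z) (hxv : x ≠ v) (hxz : x ≠ z) (hxv' : x' ≠ v)
    (hxz' : x' ≠ z) (hne : e v y ≠ e y z) (hxx : e v x ≠ e v x') (h1 : e v x ≠ e v y)
    (h2 : e v x ≠ e y z) (h1' : e v x' ≠ e v y) (h2' : e v x' ≠ e y z)
    (hwv : w ≠ v) (hwy : w ≠ y) (hwz : w ≠ z) :
    e z w = e v y ∨ e z w = e y z := by
  -- The path `x v y z w`, or for `w = x` the four-cycle `v y z x`, leaves three colors for `z w`.
  -- Comparing `x` with `x'` then excludes the color at `v`.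
  have key : ∀ x, x ≠ v → x ≠ z → e v x ≠ e v y → e v x ≠ e y z →
      e z w = e v x ∨ e z w = e v y ∨ e z w = e y z := by
    intro x hxv hxz h1 h2
    have hxy : x ≠ y := by rintro rfl; exact h1 rfl
    by_cases hwx : w = x
    · subst hwx
      have := h.not_rainbow_cycle_of_card hs hc (a := v) (b := y) (c := z) (d := w) (by grind)
      simp only [List.nodup_cons, List.mem_cons, List.not_mem_nil, not_or,
        List.nodup_nil, not_false_eq_true, and_true] at this
      have := hs w v
      grind
    · have := h.or x v y z w (by grind)
      have := hs x v
      grind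
  have := key x hxv hxz h1 h2
  have := key x' hxv' hxz' h1' h2'
  grind

/-- A vertex `z` such that any two colors can be avoided by two different colors of edges
at `v` not going to `z`. -/
def Flexible (e : V → V → K) (v z : V) : Prop :=
  ∀ p q : K, ∃ x x', x ≠ v ∧ x ≠ z ∧ x' ≠ v ∧ x' ≠ z ∧ e v x ≠ e v x' ∧
    e v x ≠ p ∧ e v x ≠ q ∧ e v x' ≠ p ∧ e v x' ≠ q

/-- If `z` fails to copy `v` at `y`, `eq_or_eq` confines its edges to the colors of `v y` and `z y`.
It then also fails to copy `v` at two vertices `x`, `x'` of further colors. The confinements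
obtained from these two have only the color of `z y` in common. -/
theorem RainbowPathFree.monochromatic_or_of_flexible [Fintype V] (h : RainbowPathFree e)
    (hs : ∀ x y, e x y = e y x) (hc : 6 ≤ Fintype.card V) {v z : V} (hvz : v ≠ z)
    (hz : Flexible e v z) :
    (∃ c, ∀ w, w ≠ v → w ≠ z → e z w = c) ∨ (∀ y, y ≠ v → y ≠ z → e z y = e v y) := by
  rw [or_iff_not_imp_right]
  intro hy
  push Not at hy
  obtain ⟨y, hyv, hyz, hne⟩ := hy
  refine ⟨e z y, ?_⟩
  have step : ∀ y, y ≠ v → y ≠ z → e z y ≠ e v y → ∀ w, w ≠ v → w ≠ y → w ≠ z →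
      e z w = e v y ∨ e z w = e z y := by
    intro y hyv hyz hne w hwv hwy hwz
    obtain ⟨x, x', a1, a2, a3, a4, a5, a6, a7, a8, a9⟩ := hz (e v y) (e y z)
    rw [hs z y] at hne ⊢
    exact h.eq_or_eq hs hc hyv.symm hvz hyz a1 a2 a3 a4 hne.symm a5 a6 a7 a8 a9 hwv hwy hwz
  obtain ⟨x, x', a1, a2, a3, a4, a5, a6, a7, a8, a9⟩ := hz (e v y) (e z y)
  have hxy : x ≠ y := by rintro rfl; exact a6 rfl
  have hxy' : x' ≠ y := by rintro rfl; exact a8 rfl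
  have b := step y hyv hyz hne
  have c1 := b x a1 hxy a2
  have c2 := b x' a3 hxy' a4
  have d1 := step x a1 a2 (by grind)
  have d2 := step x' a3 a4 (by grind)
  have e1 := d1 y hyv hxy.symm hyz
  have e2 := d2 y hyv hxy'.symm hyz
  intro w hwv hwz
  have f1 : e z x = e z y := by grind
  have f2 : e z x' = e z y := by grind
  by_cases hwy : w = y
  · rw [hwy]
  by_cases hwx : w = x
  · rw [hwx, f1]
  by_cases hwx' : w = x'
  · rw [hwx', f2]
  have g1 := d1 w hwv hwx hwz
  have g2 := d2 w hwv hwx' hwz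
  rw [f1] at g1
  rw [f2] at g2
  clear step b d1 d2
  grind

/-- All edges outside a set of at most three vertices have the same color. -/
def NearlyMonochromatic (e : V → V → K) : Prop :=
  ∃ S : Finset V, S.card ≤ 3 ∧ ∃ c, ∀ x y, x ∉ S → y ∉ S → x ≠ y → e x y = c

/-- Each vertex outside `v, u₁, u₂, u₃` is monochromatic away from `v` or copies `v`. If all are
monochromatic, their colors agree, and `u₃` need not be deleted since its remaining edges end at
such vertices. If some `z` copies `v`, the color is that of `v z`, unless `v` sees a second color
outside the `uᵢ`; this is refuted by a rainbow path. -/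
theorem RainbowPathFree.nearlyMonochromatic_of_flexible [Fintype V] (h : RainbowPathFree e)
    (hs : ∀ x y, e x y = e y x) (hc : 6 ≤ Fintype.card V) {v u₁ u₂ u₃ g : V}
    (hV : [v, u₁, u₂, u₃, g].Nodup) (hC : [e v u₁, e v u₂, e v u₃, e v g].Nodup)
    (hflex : ∀ z, z ∉ [v, u₁, u₂, u₃] → Flexible e v z) : NearlyMonochromatic e := by
  classical
  have type : ∀ z, z ∉ [v, u₁, u₂, u₃] →
      (∃ c, ∀ w, w ≠ v → w ≠ z → e z w = c) ∨ (∀ y, y ≠ v → y ≠ z → e z y = e v y) :=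
    fun z hz => h.monochromatic_or_of_flexible hs hc (by grind) (hflex z hz)
  have hg : g ∉ [v, u₁, u₂, u₃] := by grind
  by_cases hI : ∀ z, z ∉ [v, u₁, u₂, u₃] → ∃ c, ∀ w, w ≠ v → w ≠ z → e z w = c
  · obtain ⟨c, hcg⟩ := hI g hg
    have hmono : ∀ z, z ∉ [v, u₁, u₂, u₃] → ∀ w, w ≠ v → w ≠ z → e z w = c := by
      intro z hz w hwv hwz
      obtain ⟨c', hc'⟩ := hI z hz
      by_cases hzg : z = g
      · exact hzg ▸ hcg w hwv (hzg ▸ hwz)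
      · rw [hc' w hwv hwz, ← hc' g (by grind) (Ne.symm hzg), hs, hcg z (by grind) hzg]
    refine ⟨{v, u₁, u₂}, Finset.card_le_three, c, fun x y hx hy hxy => ?_⟩
    simp only [Finset.mem_insert, Finset.mem_singleton, not_or] at hx hy
    by_cases hx3 : x = u₃
    · rw [hs]
      exact hmono y (by grind) x hx.1 hxy
    · exact hmono x (by grind) y hy.1 (Ne.symm hxy)
  · push Not at hI
    obtain ⟨z, hz, hzI⟩ := hI
    have hzII := (type z hz).resolve_left (by push Not; exact hzI)
    by_cases hconst : ∀ y, y ∉ [v, u₁, u₂, u₃] → e v y = e v z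
    · refine ⟨{u₁, u₂, u₃}, Finset.card_le_three, e v z, fun x y hx hy hxy => ?_⟩
      simp only [Finset.mem_insert, Finset.mem_singleton, not_or] at hx hy
      by_cases hxv : x = v
      · subst hxv; exact hconst y (by grind)
      by_cases hyv : y = v
      · subst hyv; rw [hs]; exact hconst x (by grind)
      have hx' : x ∉ [v, u₁, u₂, u₃] := by grind
      have hy' : y ∉ [v, u₁, u₂, u₃] := by grind
      rcases type x hx' with ⟨c, hcx⟩ | hII
      · by_cases hxz : x = z
        · subst hxz; rw [hzII y hyv (Ne.symm hxy)]; exact hconst y hy'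
        · rw [hcx y hyv (Ne.symm hxy), ← hcx z (by grind) (Ne.symm hxz), hs,
            hzII x hxv hxz]; exact hconst x hx'
      · rw [hII y hyv (Ne.symm hxy)]; exact hconst y hy'
    · exfalso
      push Not at hconst
      obtain ⟨y, hy, hyz⟩ := hconst
      have hyI : ∀ y, y ∉ [v, u₁, u₂, u₃] → e v y ≠ e v z →
          ∀ w, w ≠ v → w ≠ y → e y w = e v y := by
        intro y hy hyz w hwv hwy
        have hyz' : y ≠ z := by rintro rfl; exact hyz rfl
        rcases type y hy with ⟨c, hcy⟩ | hII
        · rw [hcy w hwv hwy, ← hcy z (by grind) (Ne.symm hyz'), hs, hzII y (by grind) hyz']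
        · have h1 := hII z (by grind) (Ne.symm hyz')
          have h2 := hzII y (by grind) hyz'
          have := hs y z
          grind
      have hg2 : e v g = e v z ∨ e v g = e v y := by
        by_contra! hgz
        have h1 := hyI g hg hgz.1 y (by grind) (by grind)
        have h2 := hyI y hy hyz g (by grind) (by grind)
        have := hs g y
        grind
      have hyz' : y ≠ z := by rintro rfl; exact hyz rfl
      -- The path is `u z v u' y`: `z` copies `v`, and `y` is monochromatic in the color of `v y`.
      -- As `v g` has one of the colors of `v y` and `v z`, at most one `uᵢ` has the other, so two
      -- of the `uᵢ` can serve as `u` and `u'`.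
      have path : ∀ u u', u ≠ v → u' ≠ v → u ≠ u' → u ∉ [y, z] → u' ∉ [y, z] →
          [e v u, e v u', e v y, e v z].Nodup → False := by
        intro u u' hu hu' huu hn hn' hd
        have h1 := hzII u hu (by grind)
        have h2 := hyI y hy hyz u' hu' (by grind)
        have h3 := h.or u z v u' y (by grind)
        have := hs u z
        have := hs z v
        have := hs u' y
        grind
      simp only [List.nodup_cons, List.mem_cons, List.not_mem_nil, not_or,
        List.nodup_nil, not_false_eq_true, and_true] at hV hC hy hz
      have p1 := path u₁ u₂ (by grind) (by grind) (by grind) (by grind) (by grind)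
      have p2 := path u₁ u₃ (by grind) (by grind) (by grind) (by grind) (by grind)
      have p3 := path u₂ u₃ (by grind) (by grind) (by grind) (by grind) (by grind)
      simp only [List.nodup_cons, List.mem_cons, List.not_mem_nil, not_or,
        List.nodup_nil, not_false_eq_true, and_true, or_false] at p1 p2 p3
      clear path hyI type hflex h hzII
      by_cases q1 : e v u₁ = e v y <;> by_cases q2 : e v u₁ = e v z <;>
      by_cases q3 : e v u₂ = e v y <;> by_cases q4 : e v u₂ = e v z <;>
      by_cases q5 : e v u₃ = e v y <;> by_cases q6 : e v u₃ = e v z <;> grind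

theorem RainbowPathFree.nearlyMonochromatic_of_four [Fintype V] (h : RainbowPathFree e)
    (hs : ∀ x y, e x y = e y x) (hc : 6 ≤ Fintype.card V) {v x₁ x₂ x₃ x₄ : V}
    (hv : v ∉ [x₁, x₂, x₃, x₄]) (hC : [e v x₁, e v x₂, e v x₃, e v x₄].Nodup) :
    NearlyMonochromatic e := by
  obtain ⟨z, hz⟩ := exists_notMem_of_length_lt_card [v, x₁, x₂, x₃, x₄] (by simp; omega)
  -- The sixth vertex `z` is a substitute for `g`: whichever vertex outside `v, u₁, u₂, u₃` is
  -- omitted, `v` still sees a fourth color. Excluding `p` and `q` then leaves two colors, which is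
  -- flexibility.
  have main : ∀ u₁ u₂ u₃ g : V, v ∉ [u₁, u₂, u₃, g] → z ∉ [v, u₁, u₂, u₃, g] →
      [e v u₁, e v u₂, e v u₃, e v g].Nodup →
      (e v z = e v g ∨ e v z ∉ [e v u₁, e v u₂, e v u₃]) → NearlyMonochromatic e := by
    intro u₁ u₂ u₃ g hv hz hC hcol
    simp only [List.nodup_cons, List.mem_cons, List.not_mem_nil, not_or,
      List.nodup_nil, not_false_eq_true, and_true, or_false] at hv hz hC hcol
    refine h.nearlyMonochromatic_of_flexible hs hc (v := v) (u₁ := u₁) (u₂ := u₂) (u₃ := u₃)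
      (g := g) (by grind) (by grind) fun y hy p q => ?_
    simp only [List.mem_cons, List.not_mem_nil, not_or, or_false] at hy
    obtain ⟨g', hg'v, hg'y, hg'c⟩ : ∃ g', g' ≠ v ∧ g' ≠ y ∧ e v g' ≠ e v u₁ ∧ e v g' ≠ e v u₂ ∧
        e v g' ≠ e v u₃ := by
      by_cases hyg : y = g
      · exact ⟨z, by grind, by grind, by grind⟩
      · exact ⟨g, by grind, by grind, by grind⟩
    have w12 := fun h1 => (⟨u₁, u₂, h1⟩ : ∃ x x', x ≠ v ∧ x ≠ y ∧ x' ≠ v ∧ x' ≠ y ∧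
      e v x ≠ e v x' ∧ e v x ≠ p ∧ e v x ≠ q ∧ e v x' ≠ p ∧ e v x' ≠ q)
    have w13 := fun h1 => (⟨u₁, u₃, h1⟩ : ∃ x x', x ≠ v ∧ x ≠ y ∧ x' ≠ v ∧ x' ≠ y ∧
      e v x ≠ e v x' ∧ e v x ≠ p ∧ e v x ≠ q ∧ e v x' ≠ p ∧ e v x' ≠ q)
    have w23 := fun h1 => (⟨u₂, u₃, h1⟩ : ∃ x x', x ≠ v ∧ x ≠ y ∧ x' ≠ v ∧ x' ≠ y ∧
      e v x ≠ e v x' ∧ e v x ≠ p ∧ e v x ≠ q ∧ e v x' ≠ p ∧ e v x' ≠ q)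
    have w14 := fun h1 => (⟨u₁, g', h1⟩ : ∃ x x', x ≠ v ∧ x ≠ y ∧ x' ≠ v ∧ x' ≠ y ∧
      e v x ≠ e v x' ∧ e v x ≠ p ∧ e v x ≠ q ∧ e v x' ≠ p ∧ e v x' ≠ q)
    have w24 := fun h1 => (⟨u₂, g', h1⟩ : ∃ x x', x ≠ v ∧ x ≠ y ∧ x' ≠ v ∧ x' ≠ y ∧
      e v x ≠ e v x' ∧ e v x ≠ p ∧ e v x ≠ q ∧ e v x' ≠ p ∧ e v x' ≠ q)
    have w34 := fun h1 => (⟨u₃, g', h1⟩ : ∃ x x', x ≠ v ∧ x ≠ y ∧ x' ≠ v ∧ x' ≠ y ∧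
      e v x ≠ e v x' ∧ e v x ≠ p ∧ e v x ≠ q ∧ e v x' ≠ p ∧ e v x' ≠ q)
    generalize (∃ x x', x ≠ v ∧ x ≠ y ∧ x' ≠ v ∧ x' ≠ y ∧
      e v x ≠ e v x' ∧ e v x ≠ p ∧ e v x ≠ q ∧ e v x' ≠ p ∧ e v x' ≠ q) = P at *
    clear h hs
    by_cases p1 : e v u₁ = p <;> by_cases q1 : e v u₁ = q <;>
    by_cases p2 : e v u₂ = p <;> by_cases q2 : e v u₂ = q <;>
    by_cases p3 : e v u₃ = p <;> by_cases q3 : e v u₃ = q <;> grind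
  by_cases z1 : e v z = e v x₁
  · refine main x₂ x₃ x₄ x₁ ?_ ?_ ?_ (Or.inl z1) <;> clear main <;> grind
  by_cases z2 : e v z = e v x₂
  · refine main x₁ x₃ x₄ x₂ ?_ ?_ ?_ (Or.inl z2) <;> clear main <;> grind
  by_cases z3 : e v z = e v x₃
  · refine main x₁ x₂ x₄ x₃ ?_ ?_ ?_ (Or.inl z3) <;> clear main <;> grind
  · refine main x₁ x₂ x₃ x₄ ?_ ?_ ?_ (Or.inr ?_) <;> clear main <;> grind

end Structure

/-! ### Vertices seeing three or two colors, and the structure theorem -/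

section Structure

variable {V K : Type*} {e : V → V → K}

/-- The color of `p q` spreads: an edge `y z` of this color with `v y` colored as `v p` forces it on
all edges at `z` except `v z`. Starting from `p` and `q` it reaches every vertex other than `v, u,
u'`. -/
theorem RainbowPathFree.nearlyMonochromatic_of_same_class [Fintype V] (h : RainbowPathFree e)
    (hs : ∀ x y, e x y = e y x) (hc : 6 ≤ Fintype.card V) {v p q u u' : V}
    (hV : [v, p, q, u, u'].Nodup) (hC : [e v p, e v u, e v u', e p q].Nodup)
    (hpq : e v p = e v q) : NearlyMonochromatic e := by
  classical
  simp only [List.nodup_cons, List.mem_cons, List.not_mem_nil, not_or, List.nodup_nil,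
    not_false_eq_true, and_true, or_false] at hV hC
  -- a vertex with an edge of the color of `p q` to the class of `p`
  have full : ∀ y z, y ≠ v → z ≠ v → y ≠ u → y ≠ u' → z ≠ u → z ≠ u' → y ≠ z →
      e v y = e v p → e y z = e p q → ∀ w, w ≠ v → w ≠ z → e z w = e p q := by
    intro y z hyv hzv hyu hyu' hzu hzu' hyz hy hyz' w hwv hwz
    have s1 := fun w => h.eq_or_eq hs hc (v := v) (y := y) (z := z) (x := u) (x' := u') (w := w)
      (by grind) (by grind) (by grind) (by grind) (by grind) (by grind) (by grind) (by grind)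
      (by grind) (by grind) (by grind) (by grind) (by grind)
    have t1 := h.or u' v u z y (by grind)
    have t2 := h.or u v u' z y (by grind)
    have zu : e z u = e p q := by
      have := s1 u (by grind) (by grind) (by grind)
      have := hs z u
      have := hs z y
      have := hs u' v
      grind
    have zu' : e z u' = e p q := by
      have := s1 u' (by grind) (by grind) (by grind)
      have := hs z u'
      have := hs z y
      have := hs u v
      grind
    by_cases hwy : w = y
    · rw [hwy, hs, hyz']
    by_cases hwu : w = u
    · rw [hwu, zu]
    have uz : e u z = e p q := by rw [hs, zu]
    have r1 := s1 w hwv hwy hwz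
    have r2 := h.eq_or_eq hs hc (v := v) (y := u) (z := z) (x := y) (x' := u') (w := w)
      (by grind) (by grind) (by grind) (by grind) (by grind) (by grind) (by grind) (by grind)
      (by grind) (by grind) (by grind) (by grind) (by grind) hwv hwu hwz
    grind
  have fp := full q p (by grind) (by grind) (by grind) (by grind) (by grind) (by grind) (by grind)
    hpq.symm (hs q p)
  have fq := full p q (by grind) (by grind) (by grind) (by grind) (by grind) (by grind) (by grind)
    rfl rfl
  have fz : ∀ z, z ≠ v → z ≠ u → z ≠ u' → ∀ w, w ≠ v → w ≠ z → e z w = e p q := by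
    intro z hzv hzu hzu'
    by_cases hzp : z = p
    · exact hzp ▸ fp
    · exact full p z (by grind) hzv (by grind) (by grind) hzu hzu' (Ne.symm hzp) rfl
        (fp z hzv hzp)
  refine ⟨{v, u}, Finset.card_le_two.trans (by norm_num), e p q, fun x y hx hy hxy => ?_⟩
  simp only [Finset.mem_insert, Finset.mem_singleton, not_or] at hx hy
  by_cases hxu : x = u'
  · rw [hs]
    exact fz y hy.1 hy.2 (by grind) x hx.1 hxy
  · exact fz x hx.1 hx.2 hxu y hy.1 hxy.symm

theorem RainbowPathFree.nearlyMonochromatic_of_three [Fintype V] (h : RainbowPathFree e)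
    (hs : ∀ x y, e x y = e y x) (hc : 6 ≤ Fintype.card V) {v x₁ x₂ x₃ p q : V}
    (hv : v ∉ [x₁, x₂, x₃]) (hC : [e v x₁, e v x₂, e v x₃].Nodup)
    (hcl : ∀ y, y ≠ v → e v y = e v x₁ ∨ e v y = e v x₂ ∨ e v y = e v x₃)
    (hpq : p ≠ q) (hpq' : e p q ∉ [e v x₁, e v x₂, e v x₃]) : NearlyMonochromatic e := by
  classical
  simp only [List.nodup_cons, List.mem_cons, List.not_mem_nil, not_or, List.nodup_nil,
    not_false_eq_true, and_true, or_false] at hv hC hpq'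
  by_cases hsame : ∃ y z, y ≠ v ∧ z ≠ v ∧ y ≠ z ∧ e v y = e v z ∧ e y z ≠ e v x₁ ∧
      e y z ≠ e v x₂ ∧ e y z ≠ e v x₃
  · obtain ⟨y, z, hyv, hzv, hyz, hyz', n1, n2, n3⟩ := hsame
    rcases hcl y hyv with h1 | h1 | h1
    · exact h.nearlyMonochromatic_of_same_class hs hc (v := v) (p := y) (q := z) (u := x₂)
        (u' := x₃) (by grind) (by grind) hyz'
    · exact h.nearlyMonochromatic_of_same_class hs hc (v := v) (p := y) (q := z) (u := x₁)
        (u' := x₃) (by grind) (by grind) hyz'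
    · exact h.nearlyMonochromatic_of_same_class hs hc (v := v) (p := y) (q := z) (u := x₁)
        (u' := x₂) (by grind) (by grind) hyz'
  push Not at hsame
  have hpv : p ≠ v := by
    rintro rfl; have := hcl q hpq.symm; grind
  have hqv : q ≠ v := by
    rintro rfl; have := hcl p hpq; have := hs p q; grind
  have hpqc : e v p ≠ e v q := fun h1 => hpq'.2.2 (hsame p q hpv hqv hpq h1 hpq'.1 hpq'.2.1)
  obtain ⟨x, hxv, hxp, hxq, hcl', hpqx⟩ : ∃ x, x ≠ v ∧ e v x ≠ e v p ∧ e v x ≠ e v q ∧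
      (∀ y, y ≠ v → e v y = e v p ∨ e v y = e v q ∨ e v y = e v x) ∧ e p q ≠ e v x := by
    have h1 := hcl p hpv
    have h2 := hcl q hqv
    by_cases y1 : e v x₁ ≠ e v p ∧ e v x₁ ≠ e v q
    · exact ⟨x₁, by grind, y1.1, y1.2, fun y hy => by have := hcl y hy; grind, by grind⟩
    by_cases y2 : e v x₂ ≠ e v p ∧ e v x₂ ≠ e v q
    · exact ⟨x₂, by grind, y2.1, y2.2, fun y hy => by have := hcl y hy; grind, by grind⟩
    · exact ⟨x₃, by grind, by grind, by grind, fun y hy => by have := hcl y hy; grind, by grind⟩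
  have hpqp : e p q ≠ e v p := by have := hcl p hpv; grind
  have hpqq : e p q ≠ e v q := by have := hcl q hqv; grind
  have hno : ∀ y z, y ≠ v → z ≠ v → y ≠ z → e v y = e v z → e y z ≠ e p q := by
    intro y z hyv hzv hyz hyz' heq
    have := hsame y z hyv hzv hyz hyz'
    grind
  clear hsame hcl hC
  -- A second vertex `p'` in the class of `p` would give `p p'` the color of `v q`, making `q p p' v
  -- x` rainbow. Hence `p` and `q` are alone in their classes, and all else lies in the class of
  -- `x`.
  have uniq : ∀ p q, p ≠ v → q ≠ v → p ≠ q → e v x ≠ e v p → e v x ≠ e v q → e v p ≠ e v q →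
      e p q ≠ e v x → e p q ≠ e v p → e p q ≠ e v q →
      (∀ y z, y ≠ v → z ≠ v → y ≠ z → e v y = e v z → e y z ≠ e p q) →
      ∀ p', p' ≠ v → p' ≠ p → e v p' ≠ e v p := by
    intro p q hpv hqv hpq hxp hxq hpqc hpqx hpqp hpqq hno p' hp'v hp'p heq
    have a1 := h.eq_or_eq hs hc (v := v) (y := q) (z := p) (x := p') (x' := x) (w := p')
      (by grind) (by grind) (by grind) (by grind) (by grind) (by grind) (by grind)
      (by have := hs p q; grind)
      (by grind) (by grind) (by have := hs p q; grind) (by grind) (by have := hs p q; grind)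
      (by grind) (by grind) (by grind)
    have a2 := hno p p' hpv hp'v (Ne.symm hp'p) heq.symm
    have a3 := h.or q p p' v x (by grind)
    have := hs p q
    have := hs p' v
    grind
  have up := uniq p q hpv hqv hpq hxp hxq hpqc hpqx hpqp hpqq hno
  have uq := uniq q p hqv hpv hpq.symm hxq hxp hpqc.symm (by rwa [hs]) (by rwa [hs]) (by rwa [hs])
    (by rwa [hs q p])
  have hrest : ∀ y, y ≠ v → y ≠ p → y ≠ q → e v y = e v x := by
    intro y hyv hyp hyq
    have := hcl' y hyv
    have := up y hyv hyp
    have := uq y hyv hyq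
    grind
  refine ⟨{p, q}, Finset.card_le_two.trans (by norm_num), e v x, fun y z hy hz hyz => ?_⟩
  simp only [Finset.mem_insert, Finset.mem_singleton, not_or] at hy hz
  by_cases hyv : y = v
  · subst hyv
    exact hrest z hyz.symm hz.1 hz.2
  by_cases hzv : z = v
  · subst hzv
    rw [hs]
    exact hrest y hyz hy.1 hy.2
  have hy' := hrest y hyv hy.1 hy.2
  have hz' := hrest z hzv hz.1 hz.2
  have a1 := hno y z hyv hzv hyz (hy'.trans hz'.symm)
  have a2 := h.or q p v y z (by grind)
  have a3 := h.or p q v y z (by grind)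
  have := hs p q
  have := hs p v
  have := hs q v
  clear uniq hcl' up uq hrest hno
  grind

/-- If every vertex sees at most two colors, either at most three colors are used, or there is a
color `c` such that all other colors live on disjoint sets of vertices. -/
theorem dominant_of_local_two_coloring [Nonempty V] (hs : ∀ x y, e x y = e y x)
    (h2 : ∀ v x y z, x ≠ v → y ≠ v → z ≠ v →
      e v x = e v y ∨ e v x = e v z ∨ e v y = e v z) :
    (∃ a b c, ∀ x y, x ≠ y → e x y = a ∨ e x y = b ∨ e x y = c) ∨
    (∃ (c : K) (g : V → K), ∀ x y, x ≠ y → e x y = c ∨ (e x y = g x ∧ g x = g y)) := by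
  classical
  rw [or_iff_not_imp_left]
  intro h3
  push Not at h3
  by_cases hmono : ∀ v x y, x ≠ v → y ≠ v → e v x = e v y
  · exfalso
    obtain ⟨v⟩ := ‹Nonempty V›
    obtain ⟨x, y, hxy, hne, -⟩ := h3 (e v v) (e v v) (e v v)
    obtain ⟨z, w, hzw, hne', -⟩ := h3 (e x y) (e x y) (e x y)
    by_cases hzx : z = x
    · subst hzx
      exact hne' (hmono z w y hzw.symm hxy.symm)
    · have a1 := hmono x y z hxy.symm hzx
      have a2 := hmono z x w (Ne.symm hzx) hzw.symm
      exact hne' (by rw [← a2, hs z x, a1])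
  push Not at hmono
  obtain ⟨v, x, y, hxv, hyv, hxy⟩ := hmono
  obtain ⟨p, q, hpq, p1, p2, -⟩ := h3 (e v x) (e v y) (e v y)
  obtain ⟨p', q', hpq', p1', p2', p3'⟩ := h3 (e v x) (e v y) (e p q)
  have atv : ∀ w, w ≠ v → e v w = e v x ∨ e v w = e v y := by
    intro w hw
    have := h2 v x y w hxv hyv hw
    grind
  have hpv : p ≠ v := by rintro rfl; have := atv q; grind
  have hqv : q ≠ v := by rintro rfl; have := atv p; have := hs p q; grind
  have hpv' : p' ≠ v := by rintro rfl; have := atv q'; grind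
  have hqv' : q' ≠ v := by rintro rfl; have := atv p'; have := hs p' q'; grind
  have vp := atv p hpv
  have vp' := atv p' hpv'
  have hpp : p ≠ p' := by
    rintro rfl
    have := h2 p v q q' (Ne.symm hpv) (Ne.symm hpq) (Ne.symm hpq')
    have := hs p v
    grind
  -- The edge `p p'` must have a color seen by both `p` and `p'`, and their only possible common
  -- color is that of their edges to `v`. This is the dominant color.
  have hpp' : e v p = e v p' := by
    have := h2 p v q p' (Ne.symm hpv) (Ne.symm hpq) (Ne.symm hpp)
    have := h2 p' v q' p (Ne.symm hpv') (Ne.symm hpq') hpp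
    have := hs p v
    have := hs p' v
    have := hs p p'
    grind
  -- A vertex missing this color would see three others, on its edges to `v`, `p` and `p'`.
  have sees : ∀ w, ∃ w', w' ≠ w ∧ e w w' = e v p := by
    intro w
    by_contra! hw
    have hwv : w ≠ v := by rintro rfl; exact hw p hpv rfl
    have hwp : w ≠ p := by rintro rfl; exact hw v hpv.symm (hs _ _)
    have hwp' : w ≠ p' := by rintro rfl; exact hw v hpv'.symm (by rw [hs, hpp'])
    have a1 := h2 w v p p' hwv.symm hwp.symm hwp'.symm
    have a2 := h2 p v q w (Ne.symm hpv) (Ne.symm hpq) hwp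
    have a3 := h2 p' v q' w (Ne.symm hpv') (Ne.symm hpq') hwp'
    have a4 := atv w hwv
    have := hw v hwv.symm
    have := hw p hwp.symm
    have := hw p' hwp'.symm
    have := hs p v
    have := hs p' v
    have := hs w v
    have := hs w p
    have := hs w p'
    grind
  -- `g w` is the second color at `w`; the default is the dominant color itself.
  refine ⟨e v p, fun w => if h : ∃ w', w' ≠ w ∧ e w w' ≠ e v p then e w h.choose else e v p,
    fun a b hab => ?_⟩
  rw [or_iff_not_imp_left]
  intro hne
  have hval : ∀ a b, a ≠ b → e a b ≠ e v p →
      (if h : ∃ w', w' ≠ a ∧ e a w' ≠ e v p then e a h.choose else e v p) = e a b := by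
    intro a b hab hne
    have hex : ∃ w', w' ≠ a ∧ e a w' ≠ e v p := ⟨b, hab.symm, hne⟩
    rw [dif_pos hex]
    obtain ⟨w, hwa, hw⟩ := sees a
    have h1 := hex.choose_spec
    have := h2 a b w hex.choose hab.symm hwa h1.1
    grind
  beta_reduce
  rw [hval a b hab hne, hval b a hab.symm (by rwa [hs])]
  exact ⟨rfl, hs a b⟩

theorem RainbowPathFree.structure [Fintype V] (h : RainbowPathFree e)
    (hs : ∀ x y, e x y = e y x) (hc : 6 ≤ Fintype.card V) :
    (∃ a b c, ∀ x y, x ≠ y → e x y = a ∨ e x y = b ∨ e x y = c) ∨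
    (∃ (c : K) (g : V → K), ∀ x y, x ≠ y → e x y = c ∨ (e x y = g x ∧ g x = g y)) ∨
    NearlyMonochromatic e := by
  have : Nonempty V := Fintype.card_pos_iff.mp (by omega)
  by_cases h2 : ∀ v x y z, x ≠ v → y ≠ v → z ≠ v →
      e v x = e v y ∨ e v x = e v z ∨ e v y = e v z
  · rcases dominant_of_local_two_coloring hs h2 with h' | h'
    · exact Or.inl h'
    · exact Or.inr (Or.inl h')
  push Not at h2
  obtain ⟨v, x, y, z, hx, hy, hz, hxy, hxz, hyz⟩ := h2
  by_cases h4 : ∃ w, w ≠ v ∧ e v w ≠ e v x ∧ e v w ≠ e v y ∧ e v w ≠ e v z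
  · obtain ⟨w, hw, w1, w2, w3⟩ := h4
    exact Or.inr (Or.inr (h.nearlyMonochromatic_of_four hs hc (v := v) (x₁ := x) (x₂ := y)
      (x₃ := z) (x₄ := w) (by grind) (by grind)))
  push Not at h4
  by_cases h3 : ∀ p q, p ≠ q → e p q = e v x ∨ e p q = e v y ∨ e p q = e v z
  · exact Or.inl ⟨_, _, _, h3⟩
  push Not at h3
  obtain ⟨p, q, hpq, p1, p2, p3⟩ := h3
  refine Or.inr (Or.inr (h.nearlyMonochromatic_of_three hs hc (v := v) (x₁ := x) (x₂ := y)
      (x₃ := z) (by grind) (by grind) (fun w hw => ?_) hpq (by grind)))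
  have := h4 w hw
  grind

end Structure

/-! ### Disjoint monochromatic cliques -/

section Cliques

variable {V K : Type*} {e : V → V → K}

/-- All edges inside `s` have color `c`. -/
def MonoClique (e : V → V → K) (c : K) (s : Finset V) : Prop :=
  ∀ x ∈ s, ∀ y ∈ s, x ≠ y → e x y = c

/-- There are `n` pairwise disjoint cliques of color `c` with `r` vertices each. -/
def HasCliquesOfColor (e : V → V → K) (c : K) (n r : ℕ) : Prop :=
  ∃ s : Fin n → Finset V, (∀ i, (s i).card = r ∧ MonoClique e c (s i)) ∧
    ∀ i j, i ≠ j → Disjoint (s i) (s j)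

theorem HasCliquesOfColor.of_injective {c : K} {n r : ℕ} (f : Fin n × Fin r → V)
    (hf : Function.Injective f) (hc : ∀ i a b, a ≠ b → e (f (i, a)) (f (i, b)) = c) :
    HasCliquesOfColor e c n r := by
  classical
  refine ⟨fun i => Finset.univ.image fun a => f (i, a), fun i => ⟨?_, ?_⟩, fun i j hij => ?_⟩
  · rw [Finset.card_image_of_injective, Finset.card_univ, Fintype.card_fin]
    intro a b hab
    simpa using hf hab
  · intro x hx y hy hxy
    simp only [Finset.mem_image, Finset.mem_univ, true_and] at hx hy
    obtain ⟨a, rfl⟩ := hx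
    obtain ⟨b, rfl⟩ := hy
    exact hc i a b fun hab => hxy (by rw [hab])
  · rw [Finset.disjoint_left]
    intro x hx hy
    simp only [Finset.mem_image, Finset.mem_univ, true_and] at hx hy
    obtain ⟨a, rfl⟩ := hx
    obtain ⟨b, hb⟩ := hy
    exact hij (congrArg Prod.fst (hf hb)).symm

theorem MonoClique.hasCliquesOfColor {c : K} {s : Finset V} (h : MonoClique e c s) {n r : ℕ}
    (hs : n * r ≤ s.card) : HasCliquesOfColor e c n r := by
  obtain ⟨f⟩ : Nonempty (Fin n × Fin r ↪ s) :=
    Function.Embedding.nonempty_of_card_le (by simpa using hs)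
  refine .of_injective (fun p => (f p : V)) (Subtype.val_injective.comp f.injective) ?_
  intro i a b hab
  refine h _ (f _).2 _ (f _).2 fun heq => hab ?_
  simpa using f.injective (Subtype.ext heq)

theorem hasMonochromaticCopy_disjointCopies_iff {C : TopEdgeLabeling V K} {n r : ℕ}
    (hC : ∀ x y (h : x ≠ y), C.get x y h = e x y) :
    HasMonochromaticCopy C (disjointCopies n (completeGraph (Fin r))) ↔
      ∃ c, HasCliquesOfColor e c n r := by
  refine exists_congr fun c => ⟨?_, ?_⟩
  · rintro ⟨f⟩
    refine .of_injective f f.injective fun i a b hab => ?_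
    have : (C.labelGraph c).Adj (f (i, a)) (f (i, b)) := f.toHom.map_adj ⟨rfl, hab⟩
    rw [TopEdgeLabeling.labelGraph_adj] at this
    obtain ⟨hne, hcol⟩ := this
    exact (hC _ _ hne).symm.trans hcol
  · rintro ⟨s, hs, hd⟩
    let φ : ∀ i, Fin r ≃ s i := fun i => ((s i).equivFinOfCardEq (hs i).1).symm
    refine ⟨⟨⟨fun p => (φ p.1 p.2 : V), ?_⟩, ?_⟩⟩
    · rintro ⟨i, a⟩ ⟨j, b⟩ ⟨hij, hab⟩
      dsimp only at hij hab ⊢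
      subst hij
      have hab' : a ≠ b := hab
      have hne : (φ i a : V) ≠ φ i b := fun heq => hab' ((φ i).injective (Subtype.ext heq))
      rw [TopEdgeLabeling.labelGraph_adj]
      exact ⟨hne, by rw [hC]; exact (hs i).2 _ (φ i a).2 _ (φ i b).2 hne⟩
    · rintro ⟨i, a⟩ ⟨j, b⟩ heq
      change (φ i a : V) = φ j b at heq
      have hij : i = j := by
        by_contra hij
        exact Finset.disjoint_left.mp (hd i j hij) (φ i a).2 (heq ▸ (φ j b).2)
      subst hij
      rw [(φ i).injective (Subtype.ext heq)]

theorem HasCliquesOfColor.exists_ne {c : K} {n r : ℕ} (h : HasCliquesOfColor e c n r)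
    (hn : 1 ≤ n) (hr : 2 ≤ r) : ∃ x y, x ≠ y ∧ e x y = c := by
  obtain ⟨s, hs, -⟩ := h
  obtain ⟨x, hx, y, hy, hxy⟩ := Finset.one_lt_card.mp
    (show 1 < (s ⟨0, hn⟩).card by rw [(hs _).1]; omega)
  exact ⟨x, y, hxy, (hs _).2 x hx y hy hxy⟩

/-- Injectivity is needed only on colors in use. The bounds on `n` and `r` supply an edge of color
`c'`, hence a color to pull back to. -/
theorem exists_hasCliquesOfColor_of_comp {K' : Type*} (φ : K → K')
    (hφ : ∀ x y z w, x ≠ y → z ≠ w → φ (e x y) = φ (e z w) → e x y = e z w) {n r : ℕ}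
    (hn : 1 ≤ n) (hr : 2 ≤ r) {c' : K'} (h : HasCliquesOfColor (fun x y => φ (e x y)) c' n r) :
    ∃ c, HasCliquesOfColor e c n r := by
  obtain ⟨x, y, hxy, rfl⟩ := h.exists_ne hn hr
  obtain ⟨s, hs, hd⟩ := h
  exact ⟨e x y, s, fun i => ⟨(hs i).1, fun z hz w hw hzw =>
    hφ z w x y hzw hxy ((hs i).2 z hz w hw hzw)⟩, hd⟩

/-- The union of a maximal disjoint family of cliques meets every further clique. -/
theorem hasCliquesOfColor_or_exists_hitting (e : V → V → K) (c : K) (r n : ℕ) :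
    HasCliquesOfColor e c n r ∨ ∃ U : Finset V, U.card ≤ (n - 1) * r ∧
      ∀ s : Finset V, s.card = r → MonoClique e c s → ¬ Disjoint s U := by
  classical
  induction n with
  | zero => exact Or.inl ⟨fun _ => ∅, fun i => i.elim0, fun i => i.elim0⟩
  | succ n ih =>
    rcases ih with ⟨s, hs, hd⟩ | ⟨U, hU, hit⟩
    · by_cases hit : ∃ t : Finset V, t.card = r ∧ MonoClique e c t ∧
          Disjoint t (Finset.univ.biUnion s)
      · left
        obtain ⟨t, ht, hm, hdt⟩ := hit
        rw [Finset.disjoint_biUnion_right] at hdt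
        refine ⟨Fin.cons t s, Fin.cases ⟨ht, hm⟩ hs, ?_⟩
        refine Fin.cases (Fin.cases (fun h => absurd rfl h) fun j _ => ?_)
          fun i => Fin.cases (fun _ => ?_) fun j hij => ?_
        · simpa using hdt j (Finset.mem_univ _)
        · simpa using (hdt i (Finset.mem_univ _)).symm
        · simpa using hd i j fun h => hij (by rw [h])
      · right
        push Not at hit
        refine ⟨Finset.univ.biUnion s, ?_, hit⟩
        refine Finset.card_biUnion_le.trans ?_
        rw [Finset.sum_congr rfl fun i _ => (hs i).1]
        simp
    · exact Or.inr ⟨U, hU.trans (Nat.mul_le_mul_right _ (by omega)), hit⟩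

end Cliques

/-! ### Lexicographic three-colorings -/

section Lexicographic

variable {V α β γ : Type*} [DecidableEq α] [DecidableEq β]

/-- The coloring of pairs by the first coordinate in which the images under `h` differ. -/
def firstDiff (h : V → α × β × γ) (x y : V) : Fin 3 :=
  if (h x).1 ≠ (h y).1 then 1 else if (h x).2.1 ≠ (h y).2.1 then 2 else 0

theorem firstDiff_comm (h : V → α × β × γ) (x y : V) : firstDiff h x y = firstDiff h y x := by
  simp only [firstDiff, ne_comm]

variable {h : V → α × β × γ} {s : Finset V}

/-- Color `0` is also given to pairs with equal images, so only here is injectivity required. -/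
theorem card_le_of_firstDiff_zero [Fintype γ] (hh : Set.InjOn h s) (hs : MonoClique (firstDiff h) 0 s) :
    s.card ≤ Fintype.card γ := by
  refine Finset.card_le_card_of_injOn (fun x => (h x).2.2) (fun _ _ => Finset.mem_univ _) ?_
  intro x hx y hy hxy
  by_contra hne
  have h1 := hs x hx y hy hne
  unfold firstDiff at h1
  split_ifs at h1 with h2 h3
  · exact absurd h1 (by decide)
  · exact absurd h1 (by decide)
  · exact hne (hh hx hy (Prod.ext (not_not.mp h2) (Prod.ext (not_not.mp h3) hxy)))

theorem card_le_of_firstDiff_one [Fintype α] (hs : MonoClique (firstDiff h) 1 s) :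
    s.card ≤ Fintype.card α := by
  refine Finset.card_le_card_of_injOn (fun x => (h x).1) (fun _ _ => Finset.mem_univ _) ?_
  intro x hx y hy hxy
  by_contra hne
  have h1 := hs x hx y hy hne
  have h2 : (h x).1 = (h y).1 := hxy
  unfold firstDiff at h1
  rw [if_neg (not_not.mpr h2)] at h1
  split_ifs at h1 <;> exact absurd h1 (by decide)

theorem card_le_of_firstDiff_two [Fintype β] (hs : MonoClique (firstDiff h) 2 s) :
    s.card ≤ Fintype.card β := by
  refine Finset.card_le_card_of_injOn (fun x => (h x).2.1) (fun _ _ => Finset.mem_univ _) ?_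
  intro x hx y hy hxy
  by_contra hne
  have h1 := hs x hx y hy hne
  have h2 : (h x).2.1 = (h y).2.1 := hxy
  unfold firstDiff at h1
  rw [if_neg (not_not.mpr h2)] at h1
  split_ifs at h1 <;> exact absurd h1 (by decide)

end Lexicographic

/-! ### Ramsey's theorem -/

section Ramsey

variable {K : Type*} [Fintype K] [Nonempty K] [DecidableEq K]

/-- Ramsey's theorem for graphs and finitely many colors. -/
theorem exists_monoClique_of_card_le (t : K → ℕ) : ∃ N : ℕ, ∀ (V : Type) (e : V → V → K),
    (∀ x y, e x y = e y x) → ∀ S : Finset V, N ≤ S.card →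
      ∃ c, ∃ s ⊆ S, s.card = t c ∧ MonoClique e c s := by
  classical
  induction hm : ∑ c, t c using Nat.strong_induction_on generalizing t with
  | _ m ih =>
  by_cases h0 : ∃ c, t c = 0
  · obtain ⟨c, hc⟩ := h0
    exact ⟨0, fun V e _ S _ => ⟨c, ∅, by simp, by simp [hc], fun x hx => by simp at hx⟩⟩
  push Not at h0
  have ih' : ∀ c, ∃ N : ℕ, ∀ (V : Type) (e : V → V → K),
      (∀ x y, e x y = e y x) → ∀ S : Finset V, N ≤ S.card →
      ∃ c', ∃ s ⊆ S, s.card = Function.update t c (t c - 1) c' ∧ MonoClique e c' s := by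
    intro c
    refine ih _ ?_ _ rfl
    rw [← hm]
    refine Finset.sum_lt_sum (fun d _ => ?_) ⟨c, Finset.mem_univ _, ?_⟩
    · by_cases hd : d = c
      · subst hd; simp
      · simp [hd]
    · have := h0 c
      simp; omega
  choose N hN using ih'
  refine ⟨∑ c, N c + 1, fun V e hs S hS => ?_⟩
  obtain ⟨v, hv⟩ : S.Nonempty := Finset.card_pos.mp (by omega)
  obtain ⟨c, hc⟩ : ∃ c, N c ≤ ((S.erase v).filter fun x => e v x = c).card := by
    by_contra! hlt
    have h1 := Finset.sum_lt_sum_of_nonempty (s := (Finset.univ : Finset K))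
      Finset.univ_nonempty fun c _ => hlt c
    rw [← Finset.card_eq_sum_card_fiberwise (f := fun x => e v x)
      (fun x _ => Finset.mem_coe.mpr (Finset.mem_univ _)), Finset.card_erase_of_mem hv] at h1
    omega
  obtain ⟨c', s, hsS, hcard, hmono⟩ := hN c V e hs _ hc
  have hsub : ∀ x ∈ s, x ≠ v ∧ x ∈ S ∧ e v x = c := by
    intro x hx
    have := hsS hx
    simp only [Finset.mem_filter, Finset.mem_erase] at this
    exact ⟨this.1.1, this.1.2, this.2⟩
  by_cases hcc : c' = c
  · subst hcc
    refine ⟨c', insert v s, ?_, ?_, ?_⟩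
    · exact Finset.insert_subset hv fun x hx => (hsub x hx).2.1
    · rw [Finset.card_insert_of_notMem fun h => (hsub v h).1 rfl, hcard]
      have := h0 c'
      simp; omega
    · intro x hx y hy hxy
      rw [Finset.mem_insert] at hx hy
      rcases hx with rfl | hx <;> rcases hy with rfl | hy
      · exact absurd rfl hxy
      · exact (hsub y hy).2.2
      · rw [hs]; exact (hsub x hx).2.2
      · exact hmono x hx y hy hxy
  · exact ⟨c', s, fun x hx => (hsub x hx).2.1, by rw [hcard]; simp [hcc], hmono⟩

end Ramsey

/-! ### Reduction of a dominant coloring to three colors -/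

section Recoloring

variable {V K : Type*} {e : V → V → K}

/-- In a coloring with dominant color `c`, there are fewer than `r` colors `j ≠ c` with a clique
on `r` vertices, unless there are `n ≤ r` disjoint cliques of color `c`. -/
theorem hasCliquesOfColor_of_dominant {c : K} {g : V → K}
    (hdom : ∀ x y, x ≠ y → e x y = c ∨ (e x y = g x ∧ g x = g y)) {n r : ℕ} (hr : 2 ≤ r)
    (hn : n ≤ r) {T : Finset K}
    (hT : ∀ j ∈ T, j ≠ c ∧ ∃ s : Finset V, s.card = r ∧ MonoClique e j s) (hcard : r ≤ T.card) :
    HasCliquesOfColor e c n r := by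
  obtain ⟨ι⟩ : Nonempty (Fin r ↪ T) :=
    Function.Embedding.nonempty_of_card_le (by simpa using hcard)
  choose s hs hm using fun i => (hT (ι i) (ι i).2).2
  have hg : ∀ i, ∀ x ∈ s i, g x = ι i := by
    intro i x hx
    obtain ⟨y, hy, hyx⟩ := Finset.exists_mem_ne (show 1 < (s i).card by rw [hs]; omega) x
    have h1 := hm i x hx y hy hyx.symm
    rcases hdom x y hyx.symm with h2 | h2
    · exact absurd (h1.symm.trans h2) (hT (ι i) (ι i).2).1
    · exact h2.1.symm.trans h1
  let φ : ∀ i, Fin r ≃ s i := fun i => ((s i).equivFinOfCardEq (hs i)).symm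
  have hφ : ∀ i a j b, (φ i a : V) = φ j b → i = j ∧ a = b := by
    intro i a j b heq
    have h1 := hg i _ (φ i a).2
    rw [heq, hg j _ (φ j b).2] at h1
    have hij : i = j := (ι.injective (Subtype.ext h1)).symm
    subst hij
    exact ⟨rfl, (φ i).injective (Subtype.ext heq)⟩
  -- The `r` cliques are disjoint with only color `c` between them, so their vertices of a fixed
  -- index form a `K_r` of color `c`. Different indices give disjoint ones.
  refine .of_injective (fun p => (φ p.2 (Fin.castLE hn p.1) : V)) ?_ ?_
  · rintro ⟨a, i⟩ ⟨b, j⟩ heq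
    obtain ⟨h1, h2⟩ := hφ _ _ _ _ heq
    exact Prod.ext (Fin.castLE_injective hn h2) h1
  · intro a i j hij
    have hne : (φ i (Fin.castLE hn a) : V) ≠ φ j (Fin.castLE hn a) :=
      fun heq => hij (hφ _ _ _ _ heq).1
    refine (hdom _ _ hne).resolve_right fun h => hij ?_
    have h2 := h.2
    rw [hg i _ (φ i _).2, hg j _ (φ j _).2] at h2
    exact ι.injective (Subtype.ext h2)

/-- `c` only serves as a value for `a` and `b` when `T` is empty. -/
theorem exists_erase_erase_card_le [DecidableEq K] (T : Finset K) (c : K) :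
    ∃ a b, ((T.erase a).erase b).card ≤ T.card - 2 := by
  rcases T.eq_empty_or_nonempty with rfl | ⟨a, ha⟩
  · exact ⟨c, c, by simp⟩
  rcases (T.erase a).eq_empty_or_nonempty with h | ⟨b, hb⟩
  · exact ⟨a, a, by rw [h]; simp⟩
  · exact ⟨a, b, by rw [Finset.card_erase_of_mem hb, Finset.card_erase_of_mem ha]; omega⟩

/-- A coloring with a dominant color can be replaced by a three-coloring. -/
theorem exists_three_coloring_of_dominant [Finite K] (hs : ∀ x y, e x y = e y x) {c : K}
    {g : V → K} (hdom : ∀ x y, x ≠ y → e x y = c ∨ (e x y = g x ∧ g x = g y)) {n r : ℕ}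
    (hr : 3 ≤ r) (hn : 1 ≤ n) (hnr : n ≤ r - 1) (hno : ∀ c, ¬ HasCliquesOfColor e c n r) :
    ∃ e' : V → V → Fin 3, (∀ x y, e' x y = e' y x) ∧ ∀ c, ¬ HasCliquesOfColor e' c n r := by
  classical
  have := Fintype.ofFinite K
  set T : Finset K := Finset.univ.filter fun j =>
    j ≠ c ∧ ∃ s : Finset V, s.card = r ∧ MonoClique e j s with hTdef
  have hT : ∀ j, j ∈ T ↔ j ≠ c ∧ ∃ s : Finset V, s.card = r ∧ MonoClique e j s := by
    simp [hTdef]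
  have hTcard : T.card < r := by
    by_contra! hle
    exact hno c (hasCliquesOfColor_of_dominant hdom (by omega) (by omega)
      (fun j hj => (hT j).mp hj) hle)
  obtain ⟨a, b, hab⟩ := exists_erase_erase_card_le T c
  choose U hU hit using fun j => (hasCliquesOfColor_or_exists_hitting e j r n).resolve_left (hno j)
  set J : Finset V := ((T.erase a).erase b).biUnion U with hJ
  -- At most `r - 3` colors contribute, each at most `(r-2)r` vertices, and `(r-3)r ≤ (r-2)(r-1)`.
  have hJcard : J.card ≤ (r - 2) * ((r - 2) * (r - 1)) := by
    obtain ⟨m, rfl⟩ : ∃ m, r = m + 3 := ⟨r - 3, by omega⟩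
    calc J.card ≤ ((T.erase a).erase b).card * ((n - 1) * (m + 3)) :=
          Finset.card_biUnion_le_card_mul _ _ _ fun j _ => hU j
      _ ≤ m * ((m + 1) * (m + 3)) := by
          refine Nat.mul_le_mul (by omega) (Nat.mul_le_mul_right _ (by omega))
      _ ≤ (m + 1) * ((m + 1) * (m + 2)) := by nlinarith
  obtain ⟨h, hinj⟩ : ∃ h : V → Fin (r - 2) × Fin (r - 2) × Fin (r - 1), Set.InjOn h J := by
    obtain ⟨f⟩ : Nonempty (J ↪ Fin (r - 2) × Fin (r - 2) × Fin (r - 1)) :=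
      Function.Embedding.nonempty_of_card_le (by simpa using hJcard)
    let d : Fin (r - 2) × Fin (r - 2) × Fin (r - 1) :=
      (⟨0, by omega⟩, ⟨0, by omega⟩, ⟨0, by omega⟩)
    refine ⟨fun x => if hx : x ∈ J then f ⟨x, hx⟩ else d, fun x hx y hy hxy => ?_⟩
    simp only [Finset.mem_coe] at hx hy
    simp only [dif_pos hx, dif_pos hy] at hxy
    simpa using f.injective hxy
  -- Inside `J`, cliques of colors `1` and `2` have at most `r - 2` vertices and those of color `0`
  -- at most `r - 1`. Cross edges avoid `0`, and at an outside vertex `y` they take `1` or `2` so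
  -- that no edge from `y` to another outside vertex has the same new color. Thus a clique of color
  -- `1` or `2` gains at most one vertex by leaving `J`.
  let e' : V → V → Fin 3 := fun x y =>
    if x ∈ J then (if y ∈ J then firstDiff h x y else if g y = b then 1 else 2)
    else if y ∈ J then (if g x = b then 1 else 2)
    else if e x y = c then 0 else if e x y = b then 2 else 1
  have e'JJ : ∀ {x y}, x ∈ J → y ∈ J → e' x y = firstDiff h x y := fun hx hy => by
    simp [e', hx, hy]
  have e'JN : ∀ {x y}, x ∈ J → y ∉ J → e' x y = if g y = b then 1 else 2 := fun hx hy => by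
    simp [e', hx, hy]
  have e'NN : ∀ {x y}, x ∉ J → y ∉ J →
      e' x y = if e x y = c then 0 else if e x y = b then 2 else 1 := fun hx hy => by
    simp [e', hx, hy]
  have hs' : ∀ x y, e' x y = e' y x := by
    intro x y
    by_cases hx : x ∈ J <;> by_cases hy : y ∈ J <;> simp [e', hx, hy, hs x y, firstDiff_comm h x y]
  have gcol : ∀ {x y}, x ≠ y → e x y ≠ c → e x y = g x ∧ g x = g y := fun hxy hne =>
    (hdom _ _ hxy).resolve_left hne
  have e'1 : ∀ {x y}, x ∉ J → y ∉ J → e' x y = 1 → e x y ≠ c ∧ e x y ≠ b := by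
    intro x y hx hy h1
    rw [e'NN hx hy] at h1
    split_ifs at h1 with h2 h3
    · exact absurd h1 (by decide)
    · exact absurd h1 (by decide)
    · exact ⟨h2, h3⟩
  have e'2 : ∀ {x y}, x ∉ J → y ∉ J → e' x y = 2 → e x y ≠ c ∧ e x y = b := by
    intro x y hx hy h1
    rw [e'NN hx hy] at h1
    split_ifs at h1 with h2 h3
    · exact absurd h1 (by decide)
    · exact ⟨h2, h3⟩
    · exact absurd h1 (by decide)
  -- a clique meeting `J` has at most one vertex outside `J`
  have small : ∀ (i : Fin 3) (s : Finset V), s.card = r → MonoClique e' i s →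
      (∀ t : Finset V, ↑t ⊆ (J : Set V) → MonoClique (firstDiff h) i t → t.card ≤ r - 2) →
      (∀ x ∈ s, ∀ y ∈ s, ∀ z ∈ s, x ∈ J → y ∉ J → z ∉ J → y = z) → ∀ x ∈ s, x ∉ J := by
    intro i s hsr hm hJs hN x hx hxJ
    have h1 := Finset.card_filter_add_card_filter_not (s := s) (fun y => y ∈ J)
    have h2 : (s.filter fun y => y ∉ J).card ≤ 1 := by
      rw [Finset.card_le_one]
      intro y hy z hz
      rw [Finset.mem_filter] at hy hz
      exact hN x hx y hy.1 z hz.1 hxJ hy.2 hz.2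
    have h3 : (s.filter fun y => y ∈ J).card ≤ r - 2 := by
      refine hJs _ (fun y hy => (Finset.mem_filter.mp (Finset.mem_coe.mp hy)).2) ?_
      intro y hy z hz hyz
      rw [Finset.mem_filter] at hy hz
      rw [← e'JJ hy.2 hz.2]
      exact hm y hy.1 z hz.1 hyz
    omega
  have clique0 : ∀ s : Finset V, s.card = r → MonoClique e' 0 s → MonoClique e c s := by
    intro s hsr hm
    have cross : ∀ x ∈ s, ∀ y ∈ s, x ∈ J → y ∈ J := by
      intro x hx y hy hxJ
      by_contra hyJ
      have h1 := hm x hx y hy fun h => hyJ (h ▸ hxJ)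
      rw [e'JN hxJ hyJ] at h1
      split_ifs at h1 <;> exact absurd h1 (by decide)
    have hout : ∀ x ∈ s, x ∉ J := by
      intro x hx hxJ
      have hsub : ∀ y ∈ s, y ∈ J := fun y hy => cross x hx y hy hxJ
      have := card_le_of_firstDiff_zero (h := h) (s := s) (hinj.mono fun y hy => hsub y hy)
        fun y hy z hz hyz => by rw [← e'JJ (hsub y hy) (hsub z hz)]; exact hm y hy z hz hyz
      rw [Fintype.card_fin] at this
      omega
    intro x hx y hy hxy
    have h1 := hm x hx y hy hxy
    rw [e'NN (hout x hx) (hout y hy)] at h1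
    split_ifs at h1 with h2 h3
    · exact h2
    · exact absurd h1 (by decide)
    · exact absurd h1 (by decide)
  have clique2 : ∀ s : Finset V, s.card = r → MonoClique e' 2 s → MonoClique e b s := by
    intro s hsr hm
    have hout := small 2 s hsr hm
      (fun t _ ht => by simpa using card_le_of_firstDiff_two ht) (by
        intro x hx y hy z hz hxJ hyJ hzJ
        by_contra hyz
        have h1 := hm x hx y hy fun h => hyJ (h ▸ hxJ)
        rw [e'JN hxJ hyJ] at h1
        have h2 := e'2 hyJ hzJ (hm y hy z hz hyz)
        have h3 := gcol hyz h2.1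
        rw [if_pos (h3.1.symm.trans h2.2)] at h1
        exact absurd h1 (by decide))
    exact fun x hx y hy hxy => (e'2 (hout x hx) (hout y hy) (hm x hx y hy hxy)).2
  have clique1 : ∀ s : Finset V, s.card = r → MonoClique e' 1 s → MonoClique e a s := by
    intro s hsr hm
    have hout := small 1 s hsr hm
      (fun t _ ht => by simpa using card_le_of_firstDiff_one ht) (by
        intro x hx y hy z hz hxJ hyJ hzJ
        by_contra hyz
        have h1 := hm x hx y hy fun h => hyJ (h ▸ hxJ)
        rw [e'JN hxJ hyJ] at h1
        have h2 := e'1 hyJ hzJ (hm y hy z hz hyz)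
        have h3 := gcol hyz h2.1
        rw [if_neg fun h4 => h2.2 (h3.1.trans h4)] at h1
        exact absurd h1 (by decide))
    have hcol : ∀ x ∈ s, ∀ y ∈ s, x ≠ y →
        (e x y ≠ c ∧ e x y ≠ b) ∧ e x y = g x ∧ g x = g y := by
      intro x hx y hy hxy
      have h1 := e'1 (hout x hx) (hout y hy) (hm x hx y hy hxy)
      exact ⟨h1, gcol hxy h1.1⟩
    obtain ⟨x, hx, y, hy, hxy⟩ := Finset.one_lt_card.mp (show 1 < s.card by omega)
    -- Color `1` merges many old colors, but touching edges of non-dominant colors agree, so the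
    -- clique was already monochromatic. Were its color not `a`, it would meet `J`.
    have hmono : MonoClique e (g x) s := by
      intro z hz w hw hzw
      have h1 := (hcol z hz w hw hzw).2
      by_cases hzx : x = z
      · rw [hzx]; exact h1.1
      · rw [(hcol x hx z hz hzx).2.2]; exact h1.1
    have hxy' := hcol x hx y hy hxy
    rw [hxy'.2.1] at hxy'
    by_cases hxa : g x = a
    · rwa [hxa] at hmono
    exfalso
    have hmem : g x ∈ (T.erase a).erase b :=
      Finset.mem_erase.mpr ⟨hxy'.1.2, Finset.mem_erase.mpr
        ⟨hxa, (hT _).mpr ⟨hxy'.1.1, s, hsr, hmono⟩⟩⟩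
    obtain ⟨z, hz, hzU⟩ := Finset.not_disjoint_iff.mp (hit (g x) s hsr hmono)
    exact hout z hz (Finset.mem_biUnion.mpr ⟨g x, hmem, hzU⟩)
  refine ⟨e', hs', fun i => ?_⟩
  rintro ⟨s, hsm, hd⟩
  match i, hsm with
  | 0, hsm => exact hno c ⟨s, fun k => ⟨(hsm k).1, clique0 _ (hsm k).1 (hsm k).2⟩, hd⟩
  | 1, hsm => exact hno a ⟨s, fun k => ⟨(hsm k).1, clique1 _ (hsm k).1 (hsm k).2⟩, hd⟩
  | 2, hsm => exact hno b ⟨s, fun k => ⟨(hsm k).1, clique2 _ (hsm k).1 (hsm k).2⟩, hd⟩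

end Recoloring

/-! ### Translation to labelings and the two inequalities -/

section Main

variable {V K : Type*}

/-- A symmetric function as an edge labeling of the complete graph. -/
def labelingOfSymm (e : V → V → K) (hs : ∀ x y, e x y = e y x) : TopEdgeLabeling V K :=
  EdgeLabeling.mk (fun x y _ => e x y) fun x y _ => hs y x

theorem exists_symm_eq_get [Nonempty K] (C : TopEdgeLabeling V K) :
    ∃ e : V → V → K, (∀ x y, e x y = e y x) ∧ ∀ x y (h : x ≠ y), C.get x y h = e x y := by
  classical
  obtain ⟨d⟩ := ‹Nonempty K›
  refine ⟨fun x y => if h : x ≠ y then C.get x y h else d, fun x y => ?_, fun x y h => ?_⟩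
  · by_cases h : x = y
    · subst h; rfl
    · simp only [ne_eq, h, Ne.symm h, not_false_eq_true, dite_true]
      exact EdgeLabeling.get_comm y x _
  · simp [h]

theorem mem_ramseySet_iff {k n r N : ℕ} (hk : 1 ≤ k) :
    N ∈ ramseySet k (disjointCopies n (completeGraph (Fin r))) ↔
      ∀ e : Fin N → Fin N → Fin k, (∀ x y, e x y = e y x) →
        ∃ c, HasCliquesOfColor e c n r := by
  have : Nonempty (Fin k) := ⟨⟨0, hk⟩⟩
  constructor
  · intro h e hs
    exact (hasMonochromaticCopy_disjointCopies_iff (C := labelingOfSymm e hs)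
      fun x y h => rfl).mp (h _)
  · intro h C
    obtain ⟨e, hs, he⟩ := exists_symm_eq_get C
    exact (hasMonochromaticCopy_disjointCopies_iff he).mpr (h e hs)

theorem ramseySet_nonempty {k n r : ℕ} (hk : 1 ≤ k) :
    (ramseySet k (disjointCopies n (completeGraph (Fin r)))).Nonempty := by
  have : Nonempty (Fin k) := ⟨⟨0, hk⟩⟩
  obtain ⟨N, hN⟩ := exists_monoClique_of_card_le fun _ : Fin k => n * r
  refine ⟨N, (mem_ramseySet_iff hk).mpr fun e hs => ?_⟩
  obtain ⟨c, s, -, hcard, hm⟩ := hN _ e hs Finset.univ (by simp)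
  exact ⟨c, hm.hasCliquesOfColor hcard.ge⟩

/-- The lexicographic coloring of a cube of side `r - 1` has no monochromatic `K_r`. -/
theorem lt_of_mem_ramseySet {n r N : ℕ} (hn : 1 ≤ n) (hr : 1 ≤ r)
    (hN : N ∈ ramseySet 3 (disjointCopies n (completeGraph (Fin r)))) :
    (r - 1) * ((r - 1) * (r - 1)) < N := by
  by_contra! hle
  obtain ⟨h⟩ : Nonempty (Fin N ↪ Fin (r - 1) × Fin (r - 1) × Fin (r - 1)) :=
    Function.Embedding.nonempty_of_card_le (by simpa using hle)
  obtain ⟨c, s, hs, -⟩ := (mem_ramseySet_iff (by norm_num)).mp hN (firstDiff h) (firstDiff_comm h)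
  obtain ⟨hcard, hm⟩ := hs ⟨0, hn⟩
  have : (s ⟨0, hn⟩).card ≤ r - 1 := by
    match c, hm with
    | 0, hm => simpa using card_le_of_firstDiff_zero h.injective.injOn hm
    | 1, hm => simpa using card_le_of_firstDiff_one hm
    | 2, hm => simpa using card_le_of_firstDiff_two hm
  omega

theorem exists_eq_castSucc_succ_of_mem_edgeSet (ε : (pathGraph 5).edgeSet) :
    ∃ i : Fin 4, (ε : Sym2 (Fin 5)) = s(i.castSucc, i.succ) := by
  obtain ⟨ε, hε⟩ := ε
  induction ε using Sym2.inductionOn with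
  | _ x y =>
    rw [mem_edgeSet, pathGraph_adj] at hε
    rcases hε with hε | hε
    · refine ⟨⟨x, by omega⟩, ?_⟩
      rw [Sym2.eq_iff]
      exact Or.inl ⟨rfl, Fin.ext hε.symm⟩
    · refine ⟨⟨y, by omega⟩, ?_⟩
      rw [Sym2.eq_iff]
      exact Or.inr ⟨Fin.ext hε.symm, rfl⟩

theorem hasRainbowCopy_pathGraph_five {C : TopEdgeLabeling V K} {e : V → V → K}
    (hC : ∀ x y (h : x ≠ y), C.get x y h = e x y) {a b c d f : V}
    (hV : [a, b, c, d, f].Nodup) (hcol : [e a b, e b c, e c d, e d f].Nodup) :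
    HasRainbowCopy C (pathGraph 5) := by
  have hinj : Function.Injective [a, b, c, d, f].get := List.nodup_iff_injective_get.mp hV
  let φ : Copy (pathGraph 5) (⊤ : SimpleGraph V) :=
    ⟨⟨[a, b, c, d, f].get, fun {x y} h => fun heq => h.ne (hinj heq)⟩, hinj⟩
  have hval : ∀ (ε : (pathGraph 5).edgeSet) (i : Fin 4),
      (ε : Sym2 (Fin 5)) = s(i.castSucc, i.succ) →
      C (φ.mapEdgeSet ε) = [e a b, e b c, e c d, e d f].get i := by
    rintro ⟨ε, hε⟩ i rfl
    have hne : [a, b, c, d, f].get i.castSucc ≠ [a, b, c, d, f].get i.succ :=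
      fun heq => absurd (hinj heq) (by simp [Fin.ext_iff])
    have : C (φ.mapEdgeSet ⟨_, hε⟩) =
        C.get ([a, b, c, d, f].get i.castSucc) ([a, b, c, d, f].get i.succ) hne := rfl
    rw [this, hC]
    fin_cases i <;> rfl
  refine ⟨φ, fun ε ε' heq => ?_⟩
  obtain ⟨i, hi⟩ := exists_eq_castSucc_succ_of_mem_edgeSet ε
  obtain ⟨j, hj⟩ := exists_eq_castSucc_succ_of_mem_edgeSet ε'
  dsimp only at heq
  rw [hval ε i hi, hval ε' j hj] at heq
  have hij : i = j := List.nodup_iff_injective_get.mp hcol heq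
  exact Subtype.ext (by rw [hi, hj, hij])

theorem not_hasRainbowCopy_of_comp {m : ℕ} {C : TopEdgeLabeling V K} {C' : TopEdgeLabeling V (Fin m)}
    (hm : m ≤ 3) (φ : Fin m → K) (hC : C = EdgeLabeling.compRight C' φ) :
    ¬ HasRainbowCopy C (pathGraph 5) := by
  rintro ⟨f, hf⟩
  let ε : Fin 4 → (pathGraph 5).edgeSet := fun i =>
    ⟨s(i.castSucc, i.succ), by simp [pathGraph_adj]⟩
  have hε : Function.Injective ε := by
    intro i j hij
    have := congrArg Subtype.val hij
    simp only [ε, Sym2.eq_iff, Fin.ext_iff, Fin.val_castSucc, Fin.val_succ] at this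
    omega
  have hinj : Function.Injective fun i => C' (f.mapEdgeSet (ε i)) := by
    intro i j hij
    refine hε (hf ?_)
    subst hC
    exact congrArg φ hij
  have := Fintype.card_le_of_injective _ hinj
  simp at this
  omega

theorem exists_hasCliquesOfColor_of_rainbowPathFree {k n r N : ℕ} (hr : 3 ≤ r) (hn : 1 ≤ n)
    (hnr : n ≤ r - 1) (hN : N ∈ ramseySet 3 (disjointCopies n (completeGraph (Fin r))))
    {e : Fin N → Fin N → Fin k} (hs : ∀ x y, e x y = e y x) (he : RainbowPathFree e) :
    ∃ c, HasCliquesOfColor e c n r := by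
  classical
  have hlt := lt_of_mem_ramseySet hn (by omega) hN
  obtain ⟨m, rfl⟩ : ∃ m, r = m + 3 := ⟨r - 3, by omega⟩
  have hlt' : (m + 2) * ((m + 2) * (m + 2)) < N := hlt
  have hN6 : 6 ≤ N := by nlinarith
  -- Room for `nK_r` after deleting three vertices. The estimate is tight for `r = 3`, `n = 2`,
  -- where the lower bound gives `N ≥ 9`.
  have hN3 : n * (m + 3) + 3 ≤ N := by
    have : n * (m + 3) ≤ (m + 2) * (m + 3) := Nat.mul_le_mul_right _ hnr
    nlinarith
  rcases he.structure hs (by simpa using hN6) with ⟨a, b, c, habc⟩ | ⟨c, g, hdom⟩ | ⟨S, hS, c, hc⟩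
  · obtain ⟨c', hc'⟩ := (mem_ramseySet_iff (by norm_num)).mp hN
      (fun x y => if e x y = a then 0 else if e x y = b then 1 else 2)
      fun x y => by simp only [hs x y]
    refine exists_hasCliquesOfColor_of_comp
      (fun t => if t = a then (0 : Fin 3) else if t = b then 1 else 2) ?_ hn (by omega) hc'
    intro x y z w hxy hzw heq
    have h1 := habc x y hxy
    have h2 := habc z w hzw
    have h01 : (0 : Fin 3) ≠ 1 := by decide
    have h02 : (0 : Fin 3) ≠ 2 := by decide
    have h12 : (1 : Fin 3) ≠ 2 := by decide
    grind
  · by_contra! hno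
    obtain ⟨e', hs', hno'⟩ := exists_three_coloring_of_dominant hs hdom hr hn hnr hno
    obtain ⟨c', hc'⟩ := (mem_ramseySet_iff (by norm_num)).mp hN e' hs'
    exact hno' c' hc'
  · refine ⟨c, MonoClique.hasCliquesOfColor (s := Sᶜ) (fun x hx y hy hxy =>
      hc x y (Finset.mem_compl.mp hx) (Finset.mem_compl.mp hy) hxy) ?_⟩
    rw [Finset.card_compl, Fintype.card_fin]
    omega

theorem mem_gallaiRamseySet_of_mem_ramseySet {k n r N : ℕ} (hk : 1 ≤ k) (hr : 3 ≤ r) (hn : 1 ≤ n)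
    (hnr : n ≤ r - 1) (hN : N ∈ ramseySet 3 (disjointCopies n (completeGraph (Fin r)))) :
    N ∈ gallaiRamseySet k (pathGraph 5) (disjointCopies n (completeGraph (Fin r))) := by
  intro C
  have : Nonempty (Fin k) := ⟨⟨0, hk⟩⟩
  obtain ⟨e, hs, he⟩ := exists_symm_eq_get C
  rw [or_iff_not_imp_left]
  intro hrb
  rw [hasMonochromaticCopy_disjointCopies_iff he]
  exact exists_hasCliquesOfColor_of_rainbowPathFree hr hn hnr hN hs
    fun a b c d f hV hcol => hrb (hasRainbowCopy_pathGraph_five he hV hcol)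

theorem mem_ramseySet_of_mem_gallaiRamseySet {k n r N : ℕ} (hk : 3 ≤ k) (hr : 2 ≤ r) (hn : 1 ≤ n)
    (hN : N ∈ gallaiRamseySet k (pathGraph 5) (disjointCopies n (completeGraph (Fin r)))) :
    N ∈ ramseySet 3 (disjointCopies n (completeGraph (Fin r))) := by
  rw [mem_ramseySet_iff (by norm_num)]
  intro e hs
  have hmono := (hN (EdgeLabeling.compRight (labelingOfSymm e hs) (Fin.castLE hk))).resolve_left
    (not_hasRainbowCopy_of_comp le_rfl _ rfl)
  rw [hasMonochromaticCopy_disjointCopies_iff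
    (e := fun x y => Fin.castLE hk (e x y)) fun x y h => rfl] at hmono
  obtain ⟨c, hc⟩ := hmono
  exact exists_hasCliquesOfColor_of_comp (Fin.castLE hk)
    (fun x y z w _ _ h => Fin.castLE_injective hk h) hn hr hc

end Main

theorem mainTheorem7 (r n : ℕ) (hr : 3 ≤ r) (hn : 2 ≤ n) (hnr : n ≤ r - 1) :
    (ramseySet 3 (disjointCopies n (completeGraph (Fin r)))).Nonempty ∧
    ∀ k : ℕ, 1 ≤ k →
      (gallaiRamseySet k (pathGraph 5) (disjointCopies n (completeGraph (Fin r)))).Nonempty ∧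
      gallaiRamseyNumber k (pathGraph 5) (disjointCopies n (completeGraph (Fin r))) ≤
        ramseyNumber 3 (disjointCopies n (completeGraph (Fin r))) ∧
      (3 ≤ k →
        gallaiRamseyNumber k (pathGraph 5) (disjointCopies n (completeGraph (Fin r))) =
          ramseyNumber 3 (disjointCopies n (completeGraph (Fin r)))) := by
  have hne : (ramseySet 3 (disjointCopies n (completeGraph (Fin r)))).Nonempty :=
    ramseySet_nonempty (by norm_num)
  refine ⟨hne, fun k hk => ?_⟩
  have hmem := mem_gallaiRamseySet_of_mem_ramseySet hk hr (by omega) hnr (Nat.sInf_mem hne)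
  have hle : gallaiRamseyNumber k (pathGraph 5) (disjointCopies n (completeGraph (Fin r))) ≤
      ramseyNumber 3 (disjointCopies n (completeGraph (Fin r))) := Nat.sInf_le hmem
  exact ⟨⟨_, hmem⟩, hle, fun hk3 => le_antisymm hle (Nat.sInf_le
    (mem_ramseySet_of_mem_gallaiRamseySet hk3 (by omega) (by omega) (Nat.sInf_mem ⟨_, hmem⟩)))⟩
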